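/- Let $S\subset\mathbb R^d$ be compact and let $A$ be a measurable space. Consider a $T$-period Markov decision process with state space $S$, action space $A$, transition probabilities $P_t(ds'\mid s,a)$ and measurable real costs $c_t(s,a,s')$ (time may be part of the state, so everything may depend on the period $t\in\{0,\dots,T-1\}$), and fix a randomised policy $\pi_t(da\mid s)$. Given $s_t=s$, the action and the next state have the law $P_t(ds'\mid s,a)\,\pi_t(da\mid s)$; write $c_t=c_t(s_t,a_t,s_{t+1})$. Assume that the one-step dynamics depend continuously on the state: for each $t<T$, $E[|c_t|\mid s_t=s]$ is finite and continuous in $s$, and $s\mapsto E[f(c_t,s_{t+1})\mid s_t=s]$ is continuous for every bounded continuous $f:\mathbb R\times S\to\mathbb R$. For a real random variable $Y$ and $\alpha\in(0,1)$ let $\mathrm{VaR}_\alpha(Y)=\inf\{x: P(Y\le x)\ge\alpha\}$ be the $\alpha$-quantile and $\mathrm{CVaR}_\alpha(Y)=\frac1{1-\alpha}\int_\alpha^1\mathrm{VaR}_u(Y)\,du$. Let $k\ge2$, $0<\alpha_1<\dots<\alpha_{k-1}<1$, $p_m\in(0,1]$, $\sum_{m=1}^{k-1}p_m=1$, let $\varphi=\sum_{m=1}^{k-1}p_m\delta_{\alpha_m}$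 and let $\rho^\varphi(Y)=\int_{[0,1]}\mathrm{CVaR}_\alpha(Y)\,\varphi(d\alpha)=\sum_{m=1}^{k-1}p_m\mathrm{CVaR}_{\alpha_m}(Y)$ be the spectral risk measure with spectrum $\varphi$. Define the value function of the policy by $$V_{T-1}(s)=\rho^\varphi\big(c_{T-1}\mid s_{T-1}=s\big),\qquad V_t(s)=\rho^\varphi\big(c_t+V_{t+1}(s_{t+1})\mid s_t=s\big)\quad(0\le t<T-1).$$ Let $Y_t=c_t+V_{t+1}(s_{t+1})$, where $V_T:=0$, and define $$H_1(t,s)=\mathrm{VaR}_{\alpha_1}(Y_t\mid s_t=s),\qquad H_m(t,s)=\mathrm{VaR}_{\alpha_m}(Y_t\mid s_t=s)-\mathrm{VaR}_{\alpha_{m-1}}(Y_t\mid s_t=s)\quad(2\le m\le k-1),$$ $$H_k(t,s)=\rho^\varphi(Y_t\mid s_t=s)-\sum_{m=1}^{k-1}p_m\mathrm{VaR}_{\alpha_m}(Y_t\mid s_t=s).$$ Let $\sigma:\mathbb R\to\mathbb R$ be a continuous sigmoid activation function ($\sigma(x)\to0$ as $x\to-\infty$ and $\sigma(x)\to1$ as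 $x\to+\infty$). Then for every $\varepsilon^*>0$ there exist feed-forward neural networks $H_1^{\psi_1},\dots,H_k^{\psi_k}:\mathbb R^{1+d}\to\mathbb R$ with activation function $\sigma$, whose input is the time-augmented state $(t,s)$, with $H_m^{\psi_m}(t,s)\ge0$ for all $2\le m\le k$, $t<T$ and $s\in S$, such that for every $t<T$ $$\operatorname*{ess\,sup}_{s\in S}\Big|V_t(s)-\Big(H_k^{\psi_k}(t,s)+\sum_{m=1}^{k-1}p_m\sum_{l=1}^{m}H_l^{\psi_l}(t,s)\Big)\Big|<\varepsilon^*,$$ for the essential supremum with respect to any measure on $S$ (for instance the law of $s_t$). If moreover the $\alpha_m$-quantiles of $Y_t$ given $s_t=s$ are unique for all $m\le k-1$, $t<T$ and $s\in S$, then these networks can be chosen such that also $\operatorname{ess\,sup}_{s\in S}|H_m(t,s)-H_m^{\psi_m}(t,s)|<\varepsilon^*$ for every $m\le k$ and $t<T$. -/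

import Mathlib

open MeasureTheory ProbabilityTheory Filter Topology
open scoped ENNReal BoundedContinuousFunction Matrix

noncomputable section

namespace SpectralRL

/-! ### Static risk measures, as functions of the law of a random cost -/

/-- Value-at-risk of a law `μ` on `ℝ`: its (left) `α`-quantile. -/
def VaR (α : ℝ) (μ : Measure ℝ) : ℝ :=
  sInf {x : ℝ | α ≤ μ.real (Set.Iic x)}

/-- `x` is an `α`-quantile of `μ`: `μ(-∞, x) ≤ α ≤ μ(-∞, x]`. -/
def IsQuantile (α : ℝ) (μ : Measure ℝ) (x : ℝ) : Prop :=
  μ.real (Set.Iio x) ≤ α ∧ α ≤ μ.real (Set.Iic x)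

/-- Conditional value-at-risk (upper tail, since random variables are costs). -/
def CVaR (α : ℝ) (μ : Measure ℝ) : ℝ :=
  (1 / (1 - α)) * ∫ u in α..1, VaR u μ

/-- Spectral risk measure with spectrum `φ`. -/
def spectralRisk (φ : Measure ℝ) (μ : Measure ℝ) : ℝ :=
  ∫ α in Set.Icc (0 : ℝ) 1, CVaR α μ ∂φ

/-- The spectrum with finite support `φ = ∑ₘ pₘ δ_{αₘ}`. -/
def finiteSpectrum {n : ℕ} (p α : Fin n → ℝ) : Measure ℝ :=
  ∑ m, ENNReal.ofReal (p m) • Measure.dirac (α m)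

theorem spectralRisk_finiteSpectrum {n : ℕ} (p α : Fin n → ℝ) (hp : ∀ m, 0 ≤ p m)
    (h0 : ∀ m, 0 ≤ α m) (h1 : ∀ m, α m ≤ 1) (μ : Measure ℝ) :
    spectralRisk (finiteSpectrum p α) μ = ∑ m, p m * CVaR (α m) μ := by
  have hr : (finiteSpectrum p α).restrict (Set.Icc (0 : ℝ) 1) = finiteSpectrum p α := by
    apply Measure.restrict_eq_self_of_ae_mem
    rw [ae_iff]
    have hm : MeasurableSet {a : ℝ | ¬ a ∈ Set.Icc (0 : ℝ) 1} := measurableSet_Icc.compl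
    simp only [finiteSpectrum, Measure.coe_finsetSum, Finset.sum_apply, Measure.smul_apply,
      Measure.dirac_apply' _ hm, smul_eq_mul]
    refine Finset.sum_eq_zero fun m _ => ?_
    simp [h0 m, h1 m]
  unfold spectralRisk
  rw [hr, finiteSpectrum, integral_finsetSum_measure]
  · refine Finset.sum_congr rfl fun m _ => ?_
    rw [integral_smul_measure, integral_dirac, ENNReal.toReal_ofReal (hp m), smul_eq_mul]
  · intro m _
    exact (integrable_dirac (by simp)).smul_measure ENNReal.ofReal_ne_top

/-! ### Markov decision process, policy, value function -/

/-- The environment: state space `S`, action space `A`, transition probabilities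
`P_t(ds' | s, a)` and costs `c_t(s, a, s')`. Time is part of the state, so that the data may
depend on the period `t`. -/
structure Environment (S A : Type*) [MeasurableSpace S] [MeasurableSpace A] where
  trans : ℕ → Kernel (S × A) S
  markov : ∀ t, IsMarkovKernel (trans t)
  cost : ℕ → S → A → S → ℝ
  measurable_cost : ∀ t, Measurable fun x : S × A × S => cost t x.1 x.2.1 x.2.2

variable {S A : Type*} [MeasurableSpace S] [MeasurableSpace A]

/-- The law `P(ds' | s, a) π(da | s)` of the action and the next state when the period `t` begins
in the state `s`. -/
def stepLaw (E : Environment S A) (π : ℕ → Kernel S A) (t : ℕ) (s : S) : Measure (A × S) :=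
  (π t ⊗ₖ E.trans t) s

/-- The law of `c_t + W(s_{t+1})` given `s_t = s`. -/
def costToGoLaw (E : Environment S A) (π : ℕ → Kernel S A) (W : S → ℝ) (t : ℕ) (s : S) :
    Measure ℝ :=
  (stepLaw E π t s).map fun x => E.cost t s x.1 x.2 + W x.2

/-- The value function with `r` periods to go, by dynamic programming. -/
def valueToGo (E : Environment S A) (π : ℕ → Kernel S A) (T : ℕ) (φ : Measure ℝ) : ℕ → S → ℝ
  | 0 => fun _ => 0
  | r + 1 => fun s =>
      spectralRisk φ (costToGoLaw E π (valueToGo E π T φ r) (T - (r + 1)) s)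

/-- The value function `V(s_t)` at period `t` of the `T`-period problem whose one-step conditional
risk measures are the spectral risk measure with spectrum `φ`. -/
def value (E : Environment S A) (π : ℕ → Kernel S A) (T : ℕ) (φ : Measure ℝ) (t : ℕ) : S → ℝ :=
  valueToGo E π T φ (T - t)

/-- The law of the running risk-to-go `c_t + V(s_{t+1})` given `s_t = s` (just `c_{T-1}` at the
last period, as `V` vanishes at `T`). -/
def riskToGoLaw (E : Environment S A) (π : ℕ → Kernel S A) (T : ℕ) (φ : Measure ℝ) (t : ℕ)
    (s : S) : Measure ℝ :=
  costToGoLaw E π (value E π T φ (t + 1)) t s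

theorem value_eq (E : Environment S A) (π : ℕ → Kernel S A) (T : ℕ) (φ : Measure ℝ) (t : ℕ)
    (ht : t < T) (s : S) :
    value E π T φ t s = spectralRisk φ (riskToGoLaw E π T φ t s) := by
  obtain ⟨r, hr⟩ : ∃ r, T - t = r + 1 := ⟨T - t - 1, by omega⟩
  have h1 : T - (r + 1) = t := by omega
  have h2 : T - (t + 1) = r := by omega
  simp only [value, riskToGoLaw, hr, h2, valueToGo, h1]

theorem riskToGoLaw_last (E : Environment S A) (π : ℕ → Kernel S A) (T : ℕ) (φ : Measure ℝ)
    (hT : 0 < T) (s : S) :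
    riskToGoLaw E π T φ (T - 1) s =
      (stepLaw E π (T - 1) s).map fun x => E.cost (T - 1) s x.1 x.2 := by
  have h : T - (T - 1 + 1) = 0 := by omega
  simp [riskToGoLaw, costToGoLaw, value, h, valueToGo]

/-- The one-step law of (cost, next state) depends continuously on the current state: the cost has
a finite first moment, and the law is continuous in the state for weak convergence together with
convergence of the first absolute moment of the cost. -/
structure ContinuousDynamics [TopologicalSpace S] (E : Environment S A) (π : ℕ → Kernel S A)
    (T : ℕ) : Prop where
  integrable_cost : ∀ t < T, ∀ s,
    Integrable (fun x : A × S => E.cost t s x.1 x.2) (stepLaw E π t s)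
  continuous_law : ∀ t < T, ∀ f : (ℝ × S) →ᵇ ℝ,
    Continuous fun s => ∫ x, f (E.cost t s x.1 x.2, x.2) ∂(stepLaw E π t s)
  continuous_moment : ∀ t < T,
    Continuous fun s => ∫ x, |E.cost t s x.1 x.2| ∂(stepLaw E π t s)

/-! ### The components `H₁, …, H_k` of the value function, where `k = n + 1` -/

/-- `VaR_{α₁}` for the first index, `VaR_{αₘ} - VaR_{αₘ₋₁}` for the later ones. -/
def varIncrement {n : ℕ} (α : Fin n → ℝ) (μ : Measure ℝ) (m : Fin n) : ℝ :=
  if h : 0 < m.val then VaR (α m) μ - VaR (α ⟨m.val - 1, by omega⟩) μ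
  else VaR (α m) μ

/-- `ρ^φ - ∑ₘ pₘ VaR_{αₘ}`. -/
def spectralExcess {n : ℕ} (p α : Fin n → ℝ) (μ : Measure ℝ) : ℝ :=
  spectralRisk (finiteSpectrum p α) μ - ∑ m, p m * VaR (α m) μ

/-! ### Neural networks -/

/-- Parameters (weights and biases) of a fully connected feed-forward network with `n` inputs and
one real output, of arbitrary depth and widths. -/
inductive Network : ℕ → Type
  | output {n : ℕ} (w : Fin n → ℝ) (b : ℝ) : Network n
  | hidden {n h : ℕ} (W : Matrix (Fin h) (Fin n) ℝ) (b : Fin h → ℝ) (tail : Network h) : Network n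

/-- The function computed by a network whose hidden layers have activation function `σ`. -/
def Network.eval (σ : ℝ → ℝ) : {n : ℕ} → Network n → (Fin n → ℝ) → ℝ
  | _, .output w b, x => w ⬝ᵥ x + b
  | _, .hidden W b tail, x => tail.eval σ fun i => σ ((W *ᵥ x) i + b i)

/-- A (continuous) sigmoid activation function. -/
structure IsSigmoid (σ : ℝ → ℝ) : Prop where
  continuous : Continuous σ
  tendsto_atBot : Tendsto σ atBot (𝓝 0)
  tendsto_atTop : Tendsto σ atTop (𝓝 1)

/-- The time-augmented state `(t, s)`, which is the input of the networks. -/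
def timeState {d : ℕ} (t : ℕ) (s : Fin d → ℝ) : Fin (d + 1) → ℝ :=
  Fin.cons (t : ℝ) s

end SpectralRL

end

noncomputable section

namespace SpectralRL

/-! ### Universal approximation by networks with a sigmoid activation function -/

/-! The value function is continuous in the state even where quantiles jump. By the
Rockafellar–Uryasev formula, `(1 - a) CVaR_a` is the minimum over `x` of `(1 - a) x + E (Y - x)⁺`.
This is jointly continuous in `(s, x)` when the law of `Y` varies continuously together with its
first absolute moment, and a moment bound confines a minimiser to a compact interval independent of
`s` (`continuous_integral_VaR`). Induction over the periods to go then applies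
(`isContinuousFamily`, `continuous_value`).

The components of `V` need only be built from levels `q₁ ≤ … ≤ qₙ` that are continuous in `s` and
satisfy `qₘ ≤ CVaR_{αₘ}`. If all quantiles are unique, the levels `VaR_{αₘ}` are continuous.
Otherwise the quantile function is averaged over `[αₘ, αₘ + δ]`: this is a combination of two CVaRs,
hence continuous, and keeps both inequalities (`meanVaR_eq_CVaR_sub`, `meanVaR_le_CVaR`). Networks
approximate the increments and the excess from above and so inherit their signs
(`exists_networks_of_levels`).

Density of networks: the functions `exp (w ⬝ᵥ x)` span an algebra that separates points, so
Stone–Weierstrass applies, and a continuous function of one linear form is a limit of sums of steep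
sigmoids (`exists_sum_approx`). -/

theorem IsSigmoid.exists_bound {σ : ℝ → ℝ} (hσ : IsSigmoid σ) : ∃ B, 0 ≤ B ∧ ∀ x, |σ x| ≤ B := by
  have h1 : ∀ᶠ x in atTop, |σ x| ≤ 2 :=
    hσ.tendsto_atTop.abs.eventually_le_const (by norm_num)
  have h0 : ∀ᶠ x in atBot, |σ x| ≤ 2 :=
    hσ.tendsto_atBot.abs.eventually_le_const (by norm_num)
  obtain ⟨b, hb⟩ := eventually_atTop.1 h1
  obtain ⟨a, ha⟩ := eventually_atBot.1 h0
  obtain ⟨C, hC⟩ := (isCompact_Icc (a := a) (b := b)).exists_bound_of_continuousOn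
    hσ.continuous.continuousOn
  refine ⟨max 2 C, le_max_of_le_left (by norm_num), fun x => ?_⟩
  rcases le_total x a with h | h
  · exact (ha x h).trans (le_max_left _ _)
  rcases le_total b x with h' | h'
  · exact (hb x h').trans (le_max_left _ _)
  · exact (hC x ⟨h, h'⟩).trans (le_max_right _ _)

theorem IsSigmoid.exists_threshold {σ : ℝ → ℝ} (hσ : IsSigmoid σ) {η : ℝ} (hη : 0 < η) :
    ∃ Y, 0 < Y ∧ (∀ y, Y ≤ y → |σ y - 1| ≤ η) ∧ ∀ y, y ≤ -Y → |σ y| ≤ η := by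
  have h1 : ∀ᶠ x in atTop, |σ x - 1| ≤ η := by
    filter_upwards [Metric.tendsto_nhds.1 hσ.tendsto_atTop η hη] with x hx
    exact (Real.dist_eq _ _ ▸ hx).le
  have h0 : ∀ᶠ x in atBot, |σ x| ≤ η := by
    filter_upwards [Metric.tendsto_nhds.1 hσ.tendsto_atBot η hη] with x hx
    simpa [Real.dist_eq] using hx.le
  obtain ⟨b, hb⟩ := eventually_atTop.1 h1
  obtain ⟨a, ha⟩ := eventually_atBot.1 h0
  refine ⟨max 1 (max b (-a)), by positivity, fun y hy => hb y ?_, fun y hy => ha y ?_⟩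
  · exact (le_max_left b (-a)).trans ((le_max_right _ _).trans hy)
  · have := (le_max_right b (-a)).trans (le_max_right 1 _)
    linarith

/-- A continuous function on `[0, 1]` is a uniform limit of sums of shifted, steep sigmoids. -/
theorem IsSigmoid.exists_sum_approx {σ : ℝ → ℝ} (hσ : IsSigmoid σ) {g : ℝ → ℝ}
    (hg : Continuous g) {ε : ℝ} (hε : 0 < ε) :
    ∃ (N : ℕ) (c a b : ℕ → ℝ), ∀ x ∈ Set.Icc (0 : ℝ) 1,
      |g x - (g 0 + ∑ i ∈ Finset.range N, c i * σ (a i * x + b i))| < ε := by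
  obtain ⟨B, hB0, hB⟩ := hσ.exists_bound
  -- The error is `δ` for replacing `x` by a grid point, `δ` for all the saturated sigmoids and `δ *
  -- B` for the one in transition; 3 instead of 2 makes the bound strict.
  set δ : ℝ := ε / (3 + B) with hδdef
  have hδ : 0 < δ := by positivity
  obtain ⟨r, hr, hunif⟩ := Metric.uniformContinuousOn_iff.1
    ((isCompact_Icc (a := (0 : ℝ)) (b := 1)).uniformContinuousOn_of_continuous hg.continuousOn) δ hδ
  obtain ⟨k, hk⟩ := exists_nat_one_div_lt hr
  set N : ℕ := k + 1 with hN
  have hN0 : (0 : ℝ) < N := by positivity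
  have hNr : 1 / (N : ℝ) < r := by simpa [hN] using hk
  have hgd : ∀ x ∈ Set.Icc (0 : ℝ) 1, ∀ y ∈ Set.Icc (0 : ℝ) 1, |x - y| ≤ 1 / N →
      |g x - g y| ≤ δ := fun x hx y hy h =>
    (Real.dist_eq (g x) (g y) ▸ hunif x hx y hy (by rw [Real.dist_eq]; linarith)).le
  obtain ⟨Y, hY, hY1, hY0⟩ := hσ.exists_threshold (η := 1 / N) (by positivity)
  -- The `i`-th sigmoid is centred in the cell `[i / N, (i + 1) / N]`, and its argument is `±Y` at
  -- the endpoints. Only the cell containing `x` escapes the threshold bounds.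
  refine ⟨N, fun i => g ((i + 1 : ℕ) / N) - g (i / N), fun _ => 2 * N * Y,
    fun i => - ((2 * i + 1) * Y), fun x hx => ?_⟩
  -- At `x = 1` this gives `j = N`, and no sigmoid of the sum is in transition.
  set j : ℕ := ⌊x * N⌋₊
  have hxN : 0 ≤ x * N := mul_nonneg hx.1 hN0.le
  have hj1 : (j : ℝ) ≤ x * N := Nat.floor_le hxN
  have hj2 : x * N < j + 1 := Nat.lt_floor_add_one _
  have hjN : j ≤ N := by
    have : (j : ℝ) ≤ N := hj1.trans (by nlinarith [hx.2])
    exact_mod_cast this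
  have hpt : ∀ i : ℕ, i ≤ N → ((i : ℝ) / N) ∈ Set.Icc (0 : ℝ) 1 := fun i hi =>
    ⟨by positivity, (div_le_one hN0).2 (by exact_mod_cast hi)⟩
  have hgx : |g x - g (j / N)| ≤ δ := by
    refine hgd x hx _ (hpt j hjN) ?_
    have : x - j / N = (x * N - j) / N := by field_simp
    rw [this, abs_of_nonneg (div_nonneg (by linarith) hN0.le)]
    gcongr
    linarith
  have htel : ∑ i ∈ Finset.range N, (g ((i + 1 : ℕ) / N) - g (i / N)) * (if i < j then 1 else 0)
      = g (j / N) - g 0 := by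
    have h1 : ∑ i ∈ Finset.range j, (g ((i + 1 : ℕ) / N) - g (i / N)) = g (j / N) - g 0 := by
      have := Finset.sum_range_sub (fun i : ℕ => g ((i : ℝ) / N)) j
      simpa using this
    rw [← h1]
    simp only [mul_ite, mul_one, mul_zero]
    rw [← Finset.sum_filter]
    refine Finset.sum_congr ?_ fun _ _ => rfl
    ext i
    simp only [Finset.mem_filter, Finset.mem_range]
    omega
  have hterm : ∀ i ∈ Finset.range N, |(g ((i + 1 : ℕ) / N) - g (i / N)) *
      ((if i < j then 1 else 0) - σ (2 * N * Y * x + -((2 * i + 1) * Y)))| ≤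
        δ * (1 / N) + if i = j then δ * B else 0 := by
    intro i hi
    have hiN : i < N := Finset.mem_range.1 hi
    have hΔ : |g ((i + 1 : ℕ) / N) - g (i / N)| ≤ δ := by
      refine hgd _ (hpt _ hiN) _ (hpt _ hiN.le) ?_
      have : ((i + 1 : ℕ) : ℝ) / N - i / N = 1 / N := by push_cast; ring
      rw [this, abs_of_pos (by positivity)]
    have harg : 2 * N * Y * x + -((2 * i + 1) * Y) = (2 * (x * N) - (2 * i + 1)) * Y := by ring
    rw [abs_mul, harg]
    rcases lt_trichotomy i j with h | h | h
    · have hij : (i : ℝ) + 1 ≤ j := by exact_mod_cast h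
      rw [if_pos h, if_neg h.ne, add_zero]
      exact mul_le_mul hΔ ((abs_sub_comm _ _).trans_le (hY1 _ (by nlinarith))) (abs_nonneg _) hδ.le
    · rw [if_neg (by omega), if_pos h, zero_sub, abs_neg]
      have := mul_le_mul hΔ (hB ((2 * (x * N) - (2 * i + 1)) * Y)) (abs_nonneg _) hδ.le
      have : 0 ≤ δ * (1 / N) := by positivity
      linarith
    · have hij : (j : ℝ) + 1 ≤ i := by exact_mod_cast h
      rw [if_neg (by omega), if_neg h.ne', add_zero, zero_sub, abs_neg]
      exact mul_le_mul hΔ (hY0 _ (by nlinarith)) (abs_nonneg _) hδ.le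
  have hsum : |∑ i ∈ Finset.range N, (g ((i + 1 : ℕ) / N) - g (i / N)) *
      ((if i < j then 1 else 0) - σ (2 * N * Y * x + -((2 * i + 1) * Y)))| ≤ δ + δ * B := by
    refine (Finset.abs_sum_le_sum_abs _ _).trans ((Finset.sum_le_sum hterm).trans ?_)
    rw [Finset.sum_add_distrib, Finset.sum_const, Finset.card_range, nsmul_eq_mul,
      Finset.sum_ite_eq']
    have h1 : (N : ℝ) * (δ * (1 / N)) = δ := by field_simp
    have h2 : (if j ∈ Finset.range N then δ * B else 0) ≤ δ * B := by
      split_ifs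
      · exact le_rfl
      · positivity
    linarith
  simp only [mul_sub, Finset.sum_sub_distrib, htel] at hsum
  have hfin : δ + (δ + δ * B) < ε := by
    have : δ * (3 + B) = ε := by rw [hδdef]; field_simp
    linarith
  refine lt_of_le_of_lt ?_ hfin
  refine le_trans (le_of_eq ?_) ((abs_add_le _ _).trans (add_le_add hgx hsum))
  congr 1
  ring

/-- Compactness makes `y` bounded, so an affine change of variable carries its range into `[0, 1]`,
where the one-dimensional approximation applies. -/
theorem IsSigmoid.comp_mem_topologicalClosure {X : Type*} [TopologicalSpace X] [CompactSpace X]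
    {σ : ℝ → ℝ} (hσ : IsSigmoid σ) (W : Submodule ℝ C(X, ℝ))
    (hconst : ∀ c : ℝ, ContinuousMap.const X c ∈ W) (y : C(X, ℝ))
    (hy : ∀ a b : ℝ, (⟨σ, hσ.continuous⟩ : C(ℝ, ℝ)).comp (a • y + ContinuousMap.const X b) ∈ W)
    (g : C(ℝ, ℝ)) : g.comp y ∈ W.topologicalClosure := by
  set R : ℝ := ‖y‖ + 1
  have hR0 : 0 < R := by positivity
  have hyR : ∀ x, |y x| ≤ R := fun x => (y.norm_coe_le_norm x).trans (by linarith)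
  rw [← SetLike.mem_coe, Submodule.topologicalClosure_coe, Metric.mem_closure_iff]
  intro ε hε
  obtain ⟨N, c, a, b, h⟩ := hσ.exists_sum_approx
    (g := fun u => g (2 * R * u - R)) (by fun_prop) (half_pos hε)
  refine ⟨ContinuousMap.const X (g (2 * R * 0 - R)) + ∑ i ∈ Finset.range N,
    c i • (⟨σ, hσ.continuous⟩ : C(ℝ, ℝ)).comp
      ((a i / (2 * R)) • y + ContinuousMap.const X (a i / 2 + b i)),
    W.add_mem (hconst _) (W.sum_mem fun i _ => W.smul_mem _ (hy _ _)), ?_⟩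
  refine lt_of_le_of_lt ?_ (half_lt_self hε)
  refine (ContinuousMap.dist_le (half_pos hε).le).2 fun x => ?_
  have hx := abs_le.1 (hyR x)
  have := h ((y x + R) / (2 * R))
    ⟨div_nonneg (by linarith) (by linarith), (div_le_one (by linarith)).2 (by linarith)⟩
  rw [Real.dist_eq]
  refine le_trans (le_of_eq ?_) this.le
  have h1 : 2 * R * ((y x + R) / (2 * R)) - R = y x := by field_simp; ring
  have h2 : ∀ i, a i * ((y x + R) / (2 * R)) + b i = a i / (2 * R) * y x + (a i / 2 + b i) := by
    intro i; field_simp; ring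
  simp only [h1, h2]
  simp [ContinuousMap.sum_apply]

/-- The functions computed by networks with one hidden layer, along a map `e` into the input
space. -/
theorem exists_network_of_mem_span {X : Type*} [TopologicalSpace X] {n : ℕ} {σ : ℝ → ℝ}
    (hσ : Continuous σ) (e : C(X, Fin n → ℝ)) {f : C(X, ℝ)}
    (hf : f ∈ Submodule.span ℝ (Set.range fun q : (Fin n → ℝ) × ℝ =>
        (⟨fun x => σ (q.1 ⬝ᵥ e x + q.2), by fun_prop⟩ : C(X, ℝ))) ⊔
      Submodule.span ℝ {(1 : C(X, ℝ))}) :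
    ∃ N : Network n, ∀ x, f x = N.eval σ (e x) := by
  obtain ⟨u, hu, v, hv, rfl⟩ := Submodule.mem_sup.1 hf
  obtain ⟨b, rfl⟩ := Submodule.mem_span_singleton.1 hv
  obtain ⟨c, rfl⟩ := Finsupp.mem_span_range_iff_exists_finsupp.1 hu
  -- One hidden unit for each ridge function with a nonzero coefficient.
  let i := c.support.equivFin.symm
  refine ⟨.hidden (h := c.support.card) (Matrix.of fun j => (i j).1.1) (fun j => (i j).1.2)
    (.output (fun j => c (i j).1) b), fun x => ?_⟩
  simp only [Network.eval, ContinuousMap.add_apply, ContinuousMap.smul_apply,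
    ContinuousMap.one_apply, smul_eq_mul, mul_one, add_left_inj]
  rw [Finsupp.sum, ContinuousMap.sum_apply, ← Finset.sum_coe_sort, dotProduct,
    ← i.sum_comp]
  rfl

/-- Networks with a sigmoid activation function are dense in `C(X, ℝ)`, for a compact subspace `X`
of the input space. -/
theorem IsSigmoid.exists_network {X : Type*} [TopologicalSpace X] [CompactSpace X] {n : ℕ}
    {σ : ℝ → ℝ} (hσ : IsSigmoid σ) (e : C(X, Fin n → ℝ)) (he : Function.Injective e)
    (f : C(X, ℝ)) {ε : ℝ} (hε : 0 < ε) :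
    ∃ N : Network n, ∀ x, |f x - N.eval σ (e x)| < ε := by
  set W : Submodule ℝ C(X, ℝ) := Submodule.span ℝ (Set.range fun q : (Fin n → ℝ) × ℝ =>
        (⟨fun x => σ (q.1 ⬝ᵥ e x + q.2), by have := hσ.continuous; fun_prop⟩ : C(X, ℝ))) ⊔
      Submodule.span ℝ {(1 : C(X, ℝ))}
  let E : (Fin n → ℝ) → C(X, ℝ) := fun w => ⟨fun x => Real.exp (w ⬝ᵥ e x), by fun_prop⟩
  have hconst : ∀ c : ℝ, ContinuousMap.const X c ∈ W := fun c =>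
    Submodule.mem_sup_right (Submodule.mem_span_singleton.2 ⟨c, by ext; simp⟩)
  have hE : ∀ w, E w ∈ W.topologicalClosure := fun w => by
    refine hσ.comp_mem_topologicalClosure W hconst ⟨fun x => w ⬝ᵥ e x, by fun_prop⟩
      (fun a b => ?_) ⟨Real.exp, Real.continuous_exp⟩
    refine Submodule.mem_sup_left (Submodule.subset_span ⟨(a • w, b), ?_⟩)
    ext x
    simp
  -- Products of these exponentials are again such exponentials, so the algebra they generate is
  -- just their linear span.
  have hmon : (Submonoid.closure (Set.range E) : Set C(X, ℝ)) ⊆ Set.range E := by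
    intro z hz
    refine Submonoid.closure_induction (fun _ h => h) ⟨0, ?_⟩ ?_ hz
    · ext x; simp [E]
    · rintro _ _ _ _ ⟨w, rfl⟩ ⟨w', rfl⟩
      exact ⟨w + w', by ext x; simp [E, Real.exp_add]⟩
  have hadj : Subalgebra.toSubmodule (Algebra.adjoin ℝ (Set.range E)) ≤ W.topologicalClosure := by
    rw [Algebra.adjoin_eq_span, Submodule.span_le]
    intro z hz
    obtain ⟨w, rfl⟩ := hmon hz
    exact hE w
  have hsep : (Algebra.adjoin ℝ (Set.range E)).SeparatesPoints := by
    intro x y hxy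
    obtain ⟨i, hi⟩ := Function.ne_iff.1 (he.ne hxy)
    refine ⟨E (Pi.single i 1), ⟨E (Pi.single i 1), Algebra.subset_adjoin ⟨_, rfl⟩, rfl⟩, ?_⟩
    simpa [E] using hi
  have htop := ContinuousMap.subalgebra_topologicalClosure_eq_top_of_separatesPoints _ hsep
  have hf : f ∈ W.topologicalClosure := by
    have hf' : f ∈ (Algebra.adjoin ℝ (Set.range E)).topologicalClosure := htop ▸ Algebra.mem_top
    exact closure_minimal (s := (Algebra.adjoin ℝ (Set.range E) : Set C(X, ℝ)))
      (fun z hz => hadj hz) W.isClosed_topologicalClosure hf'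
  rw [← SetLike.mem_coe, Submodule.topologicalClosure_coe, Metric.mem_closure_iff] at hf
  obtain ⟨g, hgW, hg⟩ := hf ε hε
  obtain ⟨N, hN⟩ := exists_network_of_mem_span hσ.continuous e hgW
  refine ⟨N, fun x => ?_⟩
  rw [← hN, ← Real.dist_eq]
  exact (ContinuousMap.dist_apply_le_dist x).trans_lt hg

end SpectralRL

namespace SpectralRL

/-! ### Quantiles -/

section Quantile

variable {μ : Measure ℝ} [IsProbabilityMeasure μ] {a : ℝ}

/-- The distribution function is right-continuous, so the infimum is attained; `0 < a < 1` makes the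
set bounded below and nonempty. -/
theorem VaR_le_iff (h0 : 0 < a) (h1 : a < 1) {x : ℝ} :
    VaR a μ ≤ x ↔ a ≤ μ.real (Set.Iic x) := by
  have hne : {x : ℝ | a ≤ μ.real (Set.Iic x)}.Nonempty := by
    obtain ⟨y, hy⟩ := ((tendsto_cdf_atTop μ).eventually_const_le h1).exists
    exact ⟨y, by rwa [cdf_eq_real] at hy⟩
  have hbdd : BddBelow {x : ℝ | a ≤ μ.real (Set.Iic x)} := by
    obtain ⟨y, hy⟩ := ((tendsto_cdf_atBot μ).eventually_lt_const h0).exists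
    refine ⟨y, fun z hz => le_of_not_gt fun hzy => ?_⟩
    have h2 := monotone_cdf μ hzy.le
    rw [cdf_eq_real, cdf_eq_real] at h2
    rw [cdf_eq_real] at hy
    exact absurd (hz.trans h2) (not_le.2 hy)
  refine ⟨fun h => ?_, fun h => csInf_le hbdd h⟩
  have hlim : Tendsto (cdf μ) (𝓝[>] x) (𝓝 (cdf μ x)) :=
    ((cdf μ).right_continuous x).tendsto.mono_left (nhdsWithin_mono _ Set.Ioi_subset_Ici_self)
  rw [← cdf_eq_real]
  refine ge_of_tendsto hlim ?_
  filter_upwards [self_mem_nhdsWithin] with y hy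
  obtain ⟨z, hz, hzy⟩ := exists_lt_of_csInf_lt hne (lt_of_le_of_lt h hy)
  have h2 := monotone_cdf μ hzy.le
  rw [cdf_eq_real] at h2
  exact le_trans hz h2

theorem lt_VaR_iff (h0 : 0 < a) (h1 : a < 1) {x : ℝ} :
    x < VaR a μ ↔ μ.real (Set.Iic x) < a := by
  rw [← not_le, VaR_le_iff h0 h1, not_le]

theorem VaR_mono {b : ℝ} (h0 : 0 < a) (hab : a ≤ b) (h1 : b < 1) : VaR a μ ≤ VaR b μ :=
  (VaR_le_iff h0 (hab.trans_lt h1)).2 (hab.trans ((VaR_le_iff (h0.trans_le hab) h1).1 le_rfl))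

theorem isQuantile_VaR (h0 : 0 < a) (h1 : a < 1) : IsQuantile a μ (VaR a μ) := by
  refine ⟨?_, (VaR_le_iff h0 h1).1 le_rfl⟩
  have hlim : Tendsto (fun y => μ.real (Set.Iic y)) (𝓝[<] (VaR a μ))
      (𝓝 (μ.real (Set.Iio (VaR a μ)))) := by
    have h := (cdf μ).mono.tendsto_leftLim (VaR a μ)
    have h2 : Function.leftLim (cdf μ) (VaR a μ) = μ.real (Set.Iio (VaR a μ)) := by
      have h3 := (cdf μ).measure_Iio (tendsto_cdf_atBot μ) (VaR a μ)
      rw [measure_cdf, sub_zero] at h3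
      have h4 : 0 ≤ Function.leftLim (cdf μ) (VaR a μ) :=
        ge_of_tendsto h (Eventually.of_forall fun _ => cdf_nonneg μ _)
      rw [measureReal_def, h3, ENNReal.toReal_ofReal h4]
    rw [← h2]
    exact h.congr fun y => cdf_eq_real μ y
  refine le_of_tendsto hlim ?_
  filter_upwards [self_mem_nhdsWithin] with y hy
  exact ((lt_VaR_iff h0 h1).1 hy).le

theorem monotoneOn_VaR : MonotoneOn (fun u => VaR u μ) (Set.Ioo 0 1) :=
  fun _ ha _ hb hab => VaR_mono ha.1 hab hb.2

theorem aemeasurable_VaR : AEMeasurable (fun u => VaR u μ) (volume.restrict (Set.Ioo 0 1)) :=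
  aemeasurable_restrict_of_monotoneOn measurableSet_Ioo monotoneOn_VaR

/-- The quantile transform: `VaR_U` has law `μ` if `U` is uniform on `(0, 1)`. -/
theorem map_VaR : (volume.restrict (Set.Ioo (0 : ℝ) 1)).map (fun u => VaR u μ) = μ := by
  have : IsProbabilityMeasure (volume.restrict (Set.Ioo (0 : ℝ) 1)) := ⟨by simp⟩
  have := Measure.isProbabilityMeasure_map (aemeasurable_VaR (μ := μ))
  refine Measure.ext_of_Iic _ _ fun x => ?_
  rw [Measure.map_apply_of_aemeasurable aemeasurable_VaR measurableSet_Iic]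
  have hpre : (fun u => VaR u μ) ⁻¹' Set.Iic x ∩ Set.Ioo 0 1 =
      Set.Iic (μ.real (Set.Iic x)) ∩ Set.Ioo 0 1 := by
    ext u
    simp only [Set.mem_inter_iff, Set.mem_preimage, Set.mem_Iic, and_congr_left_iff]
    exact fun hu => VaR_le_iff hu.1 hu.2
  rw [Measure.restrict_apply' measurableSet_Ioo, hpre,
    ← ENNReal.ofReal_toReal (measure_ne_top μ (Set.Iic x)), ← measureReal_def]
  have hle : μ.real (Set.Iic x) ≤ 1 := measureReal_le_one
  -- The two sets differ at most in the point `1`.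
  have hsub : (Set.Iic (μ.real (Set.Iic x)) ∩ Set.Ioo 0 1 : Set ℝ) =ᵐ[volume]
      Set.Ioc 0 (μ.real (Set.Iic x)) := by
    have h1 : (Set.Iic (μ.real (Set.Iic x)) ∩ Set.Ioc 0 1 : Set ℝ) =
        Set.Ioc 0 (μ.real (Set.Iic x)) := by
      ext u
      simp only [Set.mem_inter_iff, Set.mem_Iic, Set.mem_Ioc]
      exact ⟨fun h => ⟨h.2.1, h.1⟩, fun h => ⟨h.2, h.1, h.2.trans hle⟩⟩
    rw [← h1]
    exact (ae_eq_refl _).inter Ioo_ae_eq_Ioc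
  rw [measure_congr hsub, Real.volume_Ioc, sub_zero]

theorem integrableOn_comp_VaR {g : ℝ → ℝ} (hg : Integrable g μ) :
    IntegrableOn (fun u => g (VaR u μ)) (Set.Ioo 0 1) := by
  rw [← map_VaR (μ := μ)] at hg
  have := (integrable_map_measure hg.aestronglyMeasurable aemeasurable_VaR).1 hg
  simpa only [IntegrableOn, Function.comp_def, map_VaR] using this

theorem setIntegral_comp_VaR {g : ℝ → ℝ} (hg : Continuous g) :
    ∫ u in Set.Ioo 0 1, g (VaR u μ) = ∫ y, g y ∂μ := by
  conv_rhs => rw [← map_VaR (μ := μ)]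
  exact (integral_map aemeasurable_VaR hg.aestronglyMeasurable).symm

theorem intervalIntegrable_comp_VaR {g : ℝ → ℝ} (hg : Integrable g μ) {a b : ℝ} (ha : 0 ≤ a)
    (hab : a ≤ b) (hb : b ≤ 1) : IntervalIntegrable (fun u => g (VaR u μ)) volume a b := by
  rw [intervalIntegrable_iff_integrableOn_Ioo_of_le hab]
  exact (integrableOn_comp_VaR hg).mono_set (Set.Ioo_subset_Ioo ha hb)

theorem integrable_posPart_sub (hμ : Integrable (fun y => y) μ) (x : ℝ) :
    Integrable (fun y => max (y - x) 0) μ :=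
  (hμ.sub (integrable_const x)).pos_part

/-- The Rockafellar–Uryasev bound. -/
theorem integral_VaR_le (hμ : Integrable (fun y => y) μ) (h0 : 0 ≤ a) (h1 : a ≤ 1) (x : ℝ) :
    ∫ u in a..1, VaR u μ ≤ (1 - a) * x + ∫ y, max (y - x) 0 ∂μ := by
  have hi := intervalIntegrable_comp_VaR (integrable_posPart_sub hμ x) h0 h1 le_rfl
  -- `VaR u ≤ x + (VaR u - x)⁺`; enlarging the range of the positive part to `(0, 1)` turns its
  -- integral into an expectation.
  have h2 : ∫ u in a..1, VaR u μ ≤ ∫ u in a..1, (x + max (VaR u μ - x) 0) := by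
    refine intervalIntegral.integral_mono_on h1 (intervalIntegrable_comp_VaR hμ h0 h1 le_rfl)
      (intervalIntegrable_const.add hi) fun u _ => ?_
    linarith [le_max_left (VaR u μ - x) 0]
  refine h2.trans ?_
  rw [intervalIntegral.integral_add intervalIntegrable_const hi, intervalIntegral.integral_const,
    smul_eq_mul]
  refine add_le_add_right ?_ _
  rw [intervalIntegral.integral_of_le h1, integral_Ioc_eq_integral_Ioo,
    ← setIntegral_comp_VaR (μ := μ) (g := fun y => max (y - x) 0) (by fun_prop)]
  exact setIntegral_mono_set (integrableOn_comp_VaR (integrable_posPart_sub hμ x))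
    (Eventually.of_forall fun u => le_max_right _ _)
    (Set.Ioo_subset_Ioo_left h0).eventuallyLE

/-- The Rockafellar–Uryasev bound is attained at the quantile. -/
theorem integral_VaR_eq (hμ : Integrable (fun y => y) μ) (h0 : 0 < a) (h1 : a < 1) :
    ∫ u in a..1, VaR u μ = (1 - a) * VaR a μ + ∫ y, max (y - VaR a μ) 0 ∂μ := by
  have hi := integrable_posPart_sub hμ (VaR a μ)
  rw [← setIntegral_comp_VaR (by fun_prop), ← integral_Ioc_eq_integral_Ioo,
    ← intervalIntegral.integral_of_le zero_le_one,
    ← intervalIntegral.integral_add_adjacent_intervals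
      (intervalIntegrable_comp_VaR hi le_rfl h0.le h1.le)
      (intervalIntegrable_comp_VaR hi h0.le h1.le le_rfl)]
  -- By monotonicity of the quantile function, the positive part vanishes below level `a` and is the
  -- plain difference above it.
  have h2 : ∫ u in (0 : ℝ)..a, max (VaR u μ - VaR a μ) 0 = 0 := by
    rw [intervalIntegral.integral_of_le h0.le]
    refine setIntegral_eq_zero_of_forall_eq_zero fun u hu => ?_
    exact max_eq_right (sub_nonpos.2 (VaR_mono hu.1 hu.2 h1))
  have h3 : ∫ u in a..1, max (VaR u μ - VaR a μ) 0 = ∫ u in a..1, (VaR u μ - VaR a μ) := by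
    rw [intervalIntegral.integral_of_le h1.le, intervalIntegral.integral_of_le h1.le,
      integral_Ioc_eq_integral_Ioo, integral_Ioc_eq_integral_Ioo]
    refine setIntegral_congr_fun measurableSet_Ioo fun u hu => ?_
    exact max_eq_left (sub_nonneg.2 (VaR_mono h0 hu.1.le hu.2))
  rw [h2, h3, intervalIntegral.integral_sub (intervalIntegrable_comp_VaR hμ h0.le h1.le le_rfl)
    intervalIntegrable_const, intervalIntegral.integral_const, smul_eq_mul]
  ring

/-- Markov's inequality: mass at least `a` lies at or below the quantile and at least `1 - a` at or
above it. The bound depends on the law only through `M`. -/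
theorem abs_VaR_le_of_integral_abs_le (hμ : Integrable (fun y => y) μ) (h0 : 0 < a) (h1 : a < 1)
    {M : ℝ} (hM : ∫ y, |y| ∂μ ≤ M) : |VaR a μ| ≤ M / a + M / (1 - a) := by
  have h1' : 0 < 1 - a := by linarith
  have hM0 : 0 ≤ M := (integral_nonneg fun y => abs_nonneg y).trans hM
  have hq := isQuantile_VaR (μ := μ) h0 h1
  set q := VaR a μ
  have hmarkov : ∀ s : Set ℝ, MeasurableSet s → ∀ c, 0 ≤ c → (∀ y ∈ s, c ≤ |y|) →
      c * μ.real s ≤ M := fun s hs c hc h => by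
    refine le_trans ?_ hM
    calc c * μ.real s = ∫ y in s, c ∂μ := by simp [mul_comm]
      _ ≤ ∫ y in s, |y| ∂μ := setIntegral_mono_on (integrable_const c).integrableOn
          hμ.abs.integrableOn hs h
      _ ≤ ∫ y, |y| ∂μ := setIntegral_le_integral hμ.abs (Eventually.of_forall fun y => abs_nonneg y)
  rw [abs_le]
  have hMa : 0 ≤ M / a := by positivity
  have hMb : 0 ≤ M / (1 - a) := by positivity
  constructor
  · rcases le_total 0 q with h | h
    · linarith
    · have := hmarkov (Set.Iic q) measurableSet_Iic (-q) (by linarith) fun y hy => by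
        rw [Set.mem_Iic] at hy
        rw [abs_of_nonpos (hy.trans h)]
        linarith
      have h3 : -q * a ≤ M := (mul_le_mul_of_nonneg_left hq.2 (by linarith)).trans this
      have := (le_div_iff₀ h0).2 h3
      linarith
  · rcases le_total q 0 with h | h
    · linarith
    · have := hmarkov (Set.Ici q) measurableSet_Ici q h fun y hy => hy.trans (le_abs_self y)
      have h4 : 1 - a ≤ μ.real (Set.Ici q) := by
        have h5 := probReal_compl_eq_one_sub (μ := μ) (measurableSet_Iio (a := q))
        rw [Set.compl_Iio] at h5
        linarith [hq.1]
      have h3 : q * (1 - a) ≤ M := (mul_le_mul_of_nonneg_left h4 h).trans this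
      have := (le_div_iff₀ h1').2 h3
      linarith

theorem VaR_mul_le_integral (hμ : Integrable (fun y => y) μ) {b : ℝ} (h0 : 0 < a) (hab : a ≤ b)
    (hb : b ≤ 1) : (b - a) * VaR a μ ≤ ∫ u in a..b, VaR u μ := by
  rw [← smul_eq_mul, ← intervalIntegral.integral_const, intervalIntegral.integral_of_le hab,
    intervalIntegral.integral_of_le hab, integral_Ioc_eq_integral_Ioo,
    integral_Ioc_eq_integral_Ioo]
  exact setIntegral_mono_on (integrableOn_const (by simp))
    ((integrableOn_comp_VaR hμ).mono_set (Set.Ioo_subset_Ioo h0.le hb)) measurableSet_Ioo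
    fun u hu => VaR_mono h0 hu.1.le (hu.2.trans_le hb)

theorem integral_le_mul_VaR (hμ : Integrable (fun y => y) μ) {b : ℝ} (h0 : 0 ≤ a) (hab : a ≤ b)
    (hb : b < 1) : ∫ u in a..b, VaR u μ ≤ (b - a) * VaR b μ := by
  rw [← smul_eq_mul, ← intervalIntegral.integral_const, intervalIntegral.integral_of_le hab,
    intervalIntegral.integral_of_le hab, integral_Ioc_eq_integral_Ioo,
    integral_Ioc_eq_integral_Ioo]
  exact setIntegral_mono_on
    ((integrableOn_comp_VaR hμ).mono_set (Set.Ioo_subset_Ioo h0 hb.le))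
    (integrableOn_const (by simp)) measurableSet_Ioo
    fun u hu => VaR_mono (h0.trans_lt hu.1) hu.2.le hb

theorem VaR_le_CVaR (hμ : Integrable (fun y => y) μ) (h0 : 0 < a) (h1 : a < 1) :
    VaR a μ ≤ CVaR a μ := by
  have h := VaR_mul_le_integral hμ h0 h1.le le_rfl
  rw [CVaR, one_div_mul_eq_div, le_div_iff₀ (by linarith)]
  linarith

end Quantile

/-- The quantile function averaged over the levels in `[a, a + δ]`. -/
def meanVaR (δ a : ℝ) (μ : Measure ℝ) : ℝ :=
  δ⁻¹ * ∫ u in a..(a + δ), VaR u μ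

section MeanVaR

variable {μ : Measure ℝ} [IsProbabilityMeasure μ] {a δ : ℝ}

theorem meanVaR_mono (hμ : Integrable (fun y => y) μ) {b : ℝ} (hδ : 0 < δ) (h0 : 0 < a)
    (hab : a ≤ b) (hb : b + δ < 1) : meanVaR δ a μ ≤ meanVaR δ b μ := by
  have key : ∀ c, ∫ u in c..(c + δ), VaR u μ = ∫ v in (0 : ℝ)..δ, VaR (c + v) μ := fun c => by
    rw [intervalIntegral.integral_comp_add_left (fun u => VaR u μ), add_zero]
  have hint : ∀ c, 0 < c → c + δ < 1 →
      IntervalIntegrable (fun v => VaR (c + v) μ) volume 0 δ := fun c hc hc1 => by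
    have := (intervalIntegrable_comp_VaR hμ hc.le (by linarith) hc1.le).comp_add_left c
    simpa using this
  refine mul_le_mul_of_nonneg_left ?_ (inv_nonneg.2 hδ.le)
  rw [key, key]
  refine intervalIntegral.integral_mono_on hδ.le (hint a h0 (by linarith))
    (hint b (by linarith) hb) fun v hv => ?_
  exact VaR_mono (by linarith [hv.1]) (by linarith) (by linarith [hv.2])

/-- This makes the averaged quantile as regular in the law as CVaR, unlike the quantile itself. -/
theorem meanVaR_eq_CVaR_sub (hμ : Integrable (fun y => y) μ) (hδ : 0 < δ) (h0 : 0 < a)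
    (h1 : a + δ < 1) :
    meanVaR δ a μ = δ⁻¹ * ((1 - a) * CVaR a μ - (1 - (a + δ)) * CVaR (a + δ) μ) := by
  have h2 : 1 - a ≠ 0 := by linarith
  have h3 : 1 - (a + δ) ≠ 0 := by linarith
  rw [meanVaR, CVaR, CVaR, ← mul_assoc, ← mul_assoc, mul_one_div_cancel h2,
    mul_one_div_cancel h3, one_mul, one_mul,
    ← intervalIntegral.integral_add_adjacent_intervals (a := a) (b := a + δ) (c := 1)
      (intervalIntegrable_comp_VaR hμ h0.le (by linarith) h1.le)
      (intervalIntegrable_comp_VaR hμ (by linarith) h1.le le_rfl), add_sub_cancel_right]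

/-- `VaR_{a + δ}` separates the values averaged on `[a, a + δ]` from those above, so the mean over
the lower levels is at most the mean over all of them. -/
theorem meanVaR_le_CVaR (hμ : Integrable (fun y => y) μ) (hδ : 0 < δ) (h0 : 0 < a)
    (h1 : a + δ < 1) : meanVaR δ a μ ≤ CVaR a μ := by
  have hA := integral_le_mul_VaR hμ h0.le (by linarith : a ≤ a + δ) h1
  have hB := VaR_mul_le_integral hμ (by linarith : 0 < a + δ) h1.le le_rfl
  rw [add_sub_cancel_left] at hA
  rw [meanVaR, CVaR, one_div_mul_eq_div, le_div_iff₀ (by linarith),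
    ← intervalIntegral.integral_add_adjacent_intervals (a := a) (b := a + δ) (c := 1)
      (intervalIntegrable_comp_VaR hμ h0.le (by linarith) h1.le)
      (intervalIntegrable_comp_VaR hμ (by linarith) h1.le le_rfl)]
  set I := ∫ u in a..(a + δ), VaR u μ
  have hm : δ⁻¹ * I ≤ VaR (a + δ) μ := by rwa [inv_mul_le_iff₀ hδ]
  have hI : δ * (δ⁻¹ * I) = I := mul_inv_cancel_left₀ hδ.ne' I
  have := mul_le_mul_of_nonneg_left hm (by linarith : 0 ≤ 1 - (a + δ))
  nlinarith

end MeanVaR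

end SpectralRL

namespace SpectralRL

/-! ### Continuity of risk measures along continuous families of laws -/

section WeakContinuity

variable {X Z : Type*} [TopologicalSpace X] [TopologicalSpace Z] [MeasurableSpace Z]
  [OpensMeasurableSpace Z] {ν : X → Measure Z}

/-- The integral is the increasing limit of the integrals of the truncations `min h N`, each of
which is continuous in `s`. -/
theorem lowerSemicontinuous_integral_of_nonneg [∀ s, IsFiniteMeasure (ν s)]
    (hν : ∀ f : Z →ᵇ ℝ, Continuous fun s => ∫ z, f z ∂(ν s)) {h : Z → ℝ} (hc : Continuous h)
    (h0 : ∀ z, 0 ≤ h z) (hi : ∀ s, Integrable h (ν s)) :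
    LowerSemicontinuous fun s => ∫ z, h z ∂(ν s) := by
  let f : ℕ → Z →ᵇ ℝ := fun N => BoundedContinuousFunction.ofNormedAddCommGroup
    (fun z => min (h z) N) (by fun_prop) N fun z => by
      rw [Real.norm_of_nonneg (le_min (h0 z) N.cast_nonneg)]
      exact min_le_right _ _
  have hfh : ∀ N z, f N z ≤ h z := fun N z => min_le_left _ _
  intro s y hy
  have hlim : Tendsto (fun N => ∫ z, f N z ∂(ν s)) atTop (𝓝 (∫ z, h z ∂(ν s))) := by
    refine tendsto_integral_of_dominated_convergence h
      (fun N => (f N).continuous.aestronglyMeasurable) (hi s) (fun N => ?_) ?_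
    · refine Eventually.of_forall fun z => ?_
      rw [Real.norm_of_nonneg (show 0 ≤ f N z from le_min (h0 z) N.cast_nonneg)]
      exact hfh N z
    · refine Eventually.of_forall fun z => tendsto_const_nhds.congr' ?_
      obtain ⟨N, hN⟩ := exists_nat_ge (h z)
      filter_upwards [eventually_ge_atTop N] with m hm
      exact (min_eq_left (hN.trans (by exact_mod_cast hm))).symm
  obtain ⟨N, hN⟩ := (hlim.eventually_const_lt hy).exists
  filter_upwards [(hν (f N)).continuousAt.eventually_const_lt hN] with s' hs'
  exact hs'.trans_le (integral_mono ((f N).integrable _) (hi s') (hfh N))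

/-- Weak convergence together with convergence of the integrals of `w` gives convergence of the
integrals of all continuous functions that are dominated by `w`. -/
theorem continuous_integral_of_abs_le [∀ s, IsFiniteMeasure (ν s)]
    (hν : ∀ f : Z →ᵇ ℝ, Continuous fun s => ∫ z, f z ∂(ν s)) {w g : Z → ℝ} (hw : Continuous w)
    (hwi : ∀ s, Integrable w (ν s)) (hwc : Continuous fun s => ∫ z, w z ∂(ν s))
    (hg : Continuous g) (hgw : ∀ z, |g z| ≤ w z) :
    Continuous fun s => ∫ z, g z ∂(ν s) := by
  -- Since `w + g ≥ 0`, its integral is lower semicontinuous, and the integral of `w` is continuous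
  -- and can be subtracted. Applied to `g` and `-g`, this gives continuity.
  have key : ∀ g : Z → ℝ, Continuous g → (∀ z, |g z| ≤ w z) →
      LowerSemicontinuous fun s => ∫ z, g z ∂(ν s) := fun g hg hgw => by
    have hgi : ∀ s, Integrable g (ν s) := fun s =>
      (hwi s).mono' hg.aestronglyMeasurable (Eventually.of_forall hgw)
    have h1 := (lowerSemicontinuous_integral_of_nonneg hν (h := fun z => w z + g z) (hw.add hg)
      (fun z => by linarith [neg_abs_le (g z), hgw z]) fun s => (hwi s).add (hgi s)).add
      hwc.neg.lowerSemicontinuous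
    refine (funext fun s => ?_ : (fun s => ∫ z, g z ∂(ν s)) = _) ▸ h1
    simp only [Pi.neg_apply]
    rw [integral_add (hwi s) (hgi s)]
    ring
  rw [continuous_iff_continuousAt]
  refine fun s => tendsto_order.2 ⟨fun y hy => key g hg hgw s y hy, fun y hy => ?_⟩
  have := key (fun z => -g z) hg.neg (fun z => by rw [abs_neg]; exact hgw z) s (-y)
    (by simp only [integral_neg]; linarith)
  filter_upwards [this] with s' hs'
  rw [integral_neg] at hs'
  linarith

end WeakContinuity

/-- A family of laws on `ℝ` with finite first moments, continuous for weak convergence together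
with convergence of the first absolute moment. -/
structure IsContinuousFamily {X : Type*} [TopologicalSpace X] (μ : X → Measure ℝ) : Prop where
  isProbabilityMeasure : ∀ s, IsProbabilityMeasure (μ s)
  integrable : ∀ s, Integrable (fun y => y) (μ s)
  continuous_integral : ∀ g : ℝ → ℝ, Continuous g → ∀ K, (∀ y, |g y| ≤ |y| + K) →
    Continuous fun s => ∫ y, g y ∂(μ s)

namespace IsContinuousFamily

variable {X : Type*} [TopologicalSpace X] {μ : X → Measure ℝ} {a : ℝ}

/-- The integral is 1-Lipschitz in `x` uniformly in `s`, so continuity in `s` for each `x` suffices.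
-/
theorem continuous_uncurry_posPart (hμ : IsContinuousFamily μ) :
    Continuous fun q : X × ℝ => ∫ y, max (y - q.2) 0 ∂(μ q.1) := by
  have := hμ.isProbabilityMeasure
  refine continuous_prod_of_continuous_lipschitzWith' _ 1 (fun s => ?_) fun x => ?_
  · refine LipschitzWith.of_dist_le_mul fun x x' => ?_
    have hi := integrable_posPart_sub (hμ.integrable s)
    simp only [NNReal.coe_one, one_mul, Real.dist_eq]
    rw [← integral_sub (hi x) (hi x')]
    refine abs_integral_le_integral_abs.trans ?_
    refine (integral_mono ((hi x).sub (hi x')).abs (integrable_const |x - x'|) fun y => ?_).trans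
      (by simp)
    refine (abs_max_sub_max_le_abs _ _ _).trans (le_of_eq ?_)
    rw [sub_sub_sub_cancel_left, abs_sub_comm]
  · refine hμ.continuous_integral (fun y => max (y - x) 0) (by fun_prop) |x| fun y => ?_
    rw [abs_of_nonneg (le_max_right _ _)]
    exact max_le ((le_abs_self _).trans (abs_sub _ _)) (by positivity)

theorem continuous_integral_VaR [CompactSpace X] (hμ : IsContinuousFamily μ) (h0 : 0 < a)
    (h1 : a < 1) : Continuous fun s => ∫ u in a..1, VaR u (μ s) := by
  have := hμ.isProbabilityMeasure
  obtain ⟨M, hM⟩ := (isCompact_range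
    (hμ.continuous_integral (fun y => |y|) continuous_abs 0 fun y => by simp)).bddAbove
  set R := M / a + M / (1 - a)
  let f : X → ℝ → ℝ := fun s x => (1 - a) * x + ∫ y, max (y - x) 0 ∂(μ s)
  have hf : Continuous ↿f := by
    have := hμ.continuous_uncurry_posPart
    change Continuous fun q : X × ℝ => (1 - a) * q.2 + ∫ y, max (y - q.2) 0 ∂(μ q.1)
    fun_prop
  refine (funext fun s => ?_ : (fun s => ∫ u in a..1, VaR u (μ s)) =
    fun s => sInf (f s '' Set.Icc (-R) R)) ▸ isCompact_Icc.continuous_sInf hf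
  have hleast : IsLeast (f s '' Set.Icc (-R) R) (∫ u in a..1, VaR u (μ s)) := by
    refine ⟨⟨VaR a (μ s), ?_, ?_⟩, ?_⟩
    · exact abs_le.1 (abs_VaR_le_of_integral_abs_le (hμ.integrable s) h0 h1 (hM ⟨s, rfl⟩))
    · exact (integral_VaR_eq (hμ.integrable s) h0 h1).symm
    · rintro _ ⟨x, -, rfl⟩
      exact integral_VaR_le (hμ.integrable s) h0.le h1.le x
  exact hleast.csInf_eq.symm

theorem continuous_CVaR [CompactSpace X] (hμ : IsContinuousFamily μ) (h0 : 0 < a) (h1 : a < 1) :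
    Continuous fun s => CVaR a (μ s) :=
  (hμ.continuous_integral_VaR h0 h1).const_mul _

theorem continuous_meanVaR [CompactSpace X] (hμ : IsContinuousFamily μ) {δ : ℝ} (hδ : 0 < δ)
    (h0 : 0 < a) (h1 : a + δ < 1) : Continuous fun s => meanVaR δ a (μ s) := by
  have := hμ.isProbabilityMeasure
  have hA := hμ.continuous_CVaR h0 (by linarith)
  have hB := hμ.continuous_CVaR (by linarith : 0 < a + δ) h1
  simp only [meanVaR_eq_CVaR_sub (hμ.integrable _) hδ h0 h1]
  fun_prop

theorem continuous_spectralRisk [CompactSpace X] (hμ : IsContinuousFamily μ) {n : ℕ}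
    {p α : Fin n → ℝ} (hp : ∀ m, 0 ≤ p m) (h0 : ∀ m, 0 < α m) (h1 : ∀ m, α m < 1) :
    Continuous fun s => spectralRisk (finiteSpectrum p α) (μ s) := by
  simp only [spectralRisk_finiteSpectrum p α hp (fun m => (h0 m).le) fun m => (h1 m).le]
  exact continuous_finsetSum _ fun m _ => (hμ.continuous_CVaR (h0 m) (h1 m)).const_mul _

/-- A bounded continuous function that separates the two sides of the interval `[b, c]`
interpolates between the distribution functions at `b` and at `c`. -/
theorem exists_continuous_between (hμ : IsContinuousFamily μ) {b c : ℝ} (hbc : b < c) :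
    ∃ F : X → ℝ, Continuous F ∧
      ∀ s, (μ s).real (Set.Iic b) ≤ F s ∧ F s ≤ (μ s).real (Set.Iic c) := by
  have := hμ.isProbabilityMeasure
  let g : ℝ → ℝ := fun y => max 0 (min 1 ((c - y) / (c - b)))
  have hg : Continuous g := by fun_prop
  have hg0 : ∀ y, 0 ≤ g y := fun y => le_max_left _ _
  have hg1 : ∀ y, g y ≤ 1 := fun y => max_le zero_le_one (min_le_left _ _)
  have hcb : 0 < c - b := sub_pos.2 hbc
  have hgi : ∀ s, Integrable g (μ s) := fun s =>
    (integrable_const (1 : ℝ)).mono' hg.aestronglyMeasurable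
      (Eventually.of_forall fun y => by rw [Real.norm_of_nonneg (hg0 y)]; exact hg1 y)
  have hind : ∀ s x, (μ s).real (Set.Iic x) = ∫ y, (Set.Iic x).indicator 1 y ∂(μ s) := fun s x =>
    (integral_indicator_one measurableSet_Iic).symm
  have hindi : ∀ s x, Integrable ((Set.Iic x).indicator (1 : ℝ → ℝ)) (μ s) := fun s x =>
    (integrable_const (1 : ℝ)).indicator measurableSet_Iic
  refine ⟨fun s => ∫ y, g y ∂(μ s), hμ.continuous_integral g hg 1 fun y => ?_, fun s => ⟨?_, ?_⟩⟩
  · rw [abs_of_nonneg (hg0 y)]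
    linarith [hg1 y, abs_nonneg y]
  · rw [hind]
    refine integral_mono (hindi s b) (hgi s) fun y => Set.indicator_le' (fun y hy => ?_)
      (fun y _ => hg0 y) y
    refine le_max_of_le_right (le_min le_rfl ((one_le_div hcb).2 ?_))
    linarith [Set.mem_Iic.1 hy]
  · rw [hind]
    refine integral_mono (hgi s) (hindi s c) fun y => ?_
    by_cases hy : y ∈ Set.Iic c
    · rw [Set.indicator_of_mem hy]
      exact hg1 y
    · rw [Set.indicator_of_notMem hy]
      have hy' : c < y := not_le.1 hy
      exact max_le le_rfl ((min_le_right _ _).trans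
        (div_nonpos_of_nonpos_of_nonneg (by linarith) hcb.le))

/-- Lower semicontinuity holds without uniqueness, which serves only to exclude an upward jump. -/
theorem continuous_VaR (hμ : IsContinuousFamily μ) (h0 : 0 < a) (h1 : a < 1)
    (huniq : ∀ s, ∃! x, IsQuantile a (μ s) x) : Continuous fun s => VaR a (μ s) := by
  have := hμ.isProbabilityMeasure
  rw [continuous_iff_continuousAt]
  refine fun s => tendsto_order.2 ⟨fun y hy => ?_, fun y hy => ?_⟩
  · obtain ⟨z, hyz, hz⟩ := exists_between hy
    obtain ⟨F, hF, hb⟩ := hμ.exists_continuous_between hyz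
    have hlt : F s < a := (hb s).2.trans_lt ((lt_VaR_iff h0 h1).1 hz)
    filter_upwards [hF.continuousAt.eventually_lt_const hlt] with s' hs'
    exact (lt_VaR_iff h0 h1).2 ((hb s').1.trans_lt hs')
  · obtain ⟨z, hz, hzy⟩ := exists_between hy
    obtain ⟨x, hx, hxz⟩ := exists_between hz
    obtain ⟨F, hF, hb⟩ := hμ.exists_continuous_between hxz
    -- Otherwise `x`, lying above the quantile, would be a second quantile.
    have hlt : a < (μ s).real (Set.Iic x) := by
      by_contra hle
      have hq : IsQuantile a (μ s) x :=
        ⟨(measureReal_mono Set.Iio_subset_Iic_self).trans (not_lt.1 hle),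
          (VaR_le_iff h0 h1).1 hx.le⟩
      exact hx.ne ((huniq s).unique (isQuantile_VaR h0 h1) hq)
    filter_upwards [hF.continuousAt.eventually_const_lt (hlt.trans_le (hb s).1)] with s' hs'
    exact ((VaR_le_iff h0 h1).2 (hs'.le.trans (hb s').2)).trans_lt hzy

end IsContinuousFamily

end SpectralRL

namespace SpectralRL

/-! ### Continuity of the value function -/

section Dynamics

variable {S A : Type*} [MeasurableSpace S] [MeasurableSpace A]

theorem isProbabilityMeasure_stepLaw (E : Environment S A) {π : ℕ → Kernel S A}
    (hπ : ∀ t, IsMarkovKernel (π t)) (t : ℕ) (s : S) : IsProbabilityMeasure (stepLaw E π t s) := by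
  have := hπ t
  have := E.markov t
  unfold stepLaw
  infer_instance

variable [TopologicalSpace S] [BorelSpace S] [SecondCountableTopology S] [CompactSpace S]

/-- `W` is bounded by compactness, so a test function of `c + W(s')` with linear growth is a
continuous function of `(c, s')` dominated by `|c|` plus a constant. -/
theorem ContinuousDynamics.isContinuousFamily {E : Environment S A} {π : ℕ → Kernel S A}
    {T : ℕ} (hcont : ContinuousDynamics E π T) (hπ : ∀ t, IsMarkovKernel (π t)) {t : ℕ}
    (ht : t < T) {W : S → ℝ} (hW : Continuous W) :
    IsContinuousFamily (costToGoLaw E π W t) := by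
  have := isProbabilityMeasure_stepLaw E hπ t
  have hcost : ∀ s, Measurable fun x : A × S => E.cost t s x.1 x.2 := fun s =>
    (E.measurable_cost t).comp (measurable_const.prodMk measurable_id)
  have hsum : ∀ s, Measurable fun x : A × S => E.cost t s x.1 x.2 + W x.2 := fun s =>
    (hcost s).add (hW.measurable.comp measurable_snd)
  have hF : ∀ s, Measurable fun x : A × S => (E.cost t s x.1 x.2, x.2) := fun s =>
    (hcost s).prodMk measurable_snd
  obtain ⟨C, hC⟩ := isCompact_univ.exists_bound_of_continuousOn hW.continuousOn
  refine ⟨fun s => Measure.isProbabilityMeasure_map (hsum s).aemeasurable, fun s => ?_,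
    fun g hg K hgK => ?_⟩
  · refine (integrable_map_measure (by fun_prop) (hsum s).aemeasurable).2 ?_
    refine (hcont.integrable_cost t ht s).add ((integrable_const C).mono'
      (hW.measurable.comp measurable_snd).aestronglyMeasurable (Eventually.of_forall fun x => ?_))
    exact hC x.2 trivial
  · let ν : S → Measure (ℝ × S) := fun s =>
      (stepLaw E π t s).map fun x => (E.cost t s x.1 x.2, x.2)
    have hνp : ∀ s, IsProbabilityMeasure (ν s) := fun s =>
      Measure.isProbabilityMeasure_map (hF s).aemeasurable
    have hν : ∀ f : (ℝ × S) →ᵇ ℝ, Continuous fun s => ∫ z, f z ∂(ν s) := fun f => by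
      refine (funext fun s => ?_ : (fun s => ∫ z, f z ∂(ν s)) = _) ▸ hcont.continuous_law t ht f
      exact integral_map (hF s).aemeasurable f.continuous.aestronglyMeasurable
    have habs : ∀ s, Integrable (fun z : ℝ × S => |z.1|) (ν s) := fun s =>
      (integrable_map_measure (by fun_prop) (hF s).aemeasurable).2 (hcont.integrable_cost t ht s).abs
    have hmom : Continuous fun s => ∫ z : ℝ × S, |z.1| ∂(ν s) := by
      refine (funext fun s => ?_ : (fun s => ∫ z : ℝ × S, |z.1| ∂(ν s)) = _) ▸
        hcont.continuous_moment t ht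
      exact integral_map (hF s).aemeasurable (by fun_prop)
    have hmain := continuous_integral_of_abs_le hν (w := fun z => |z.1| + (C + K))
      (g := fun z => g (z.1 + W z.2)) (by fun_prop)
      (fun s => (habs s).add (integrable_const _))
      (by
        simp only [integral_add (habs _) (integrable_const _), integral_const, probReal_univ,
          one_smul]
        fun_prop)
      (by fun_prop) fun z => by
        have h1 := hgK (z.1 + W z.2)
        have h2 := abs_add_le z.1 (W z.2)
        have h3 := hC z.2 trivial
        rw [Real.norm_eq_abs] at h3
        linarith
    refine (funext fun s => ?_ : (fun s => ∫ y, g y ∂(costToGoLaw E π W t s)) = _) ▸ hmain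
    rw [costToGoLaw, integral_map (hsum s).aemeasurable hg.aestronglyMeasurable,
      integral_map (hF s).aemeasurable
        (by fun_prop : Continuous fun z : ℝ × S => g (z.1 + W z.2)).aestronglyMeasurable]

theorem ContinuousDynamics.continuous_value {E : Environment S A} {π : ℕ → Kernel S A}
    {T : ℕ} (hcont : ContinuousDynamics E π T) (hπ : ∀ t, IsMarkovKernel (π t))
    {n : ℕ} {p α : Fin n → ℝ} (hp : ∀ m, 0 ≤ p m) (h0 : ∀ m, 0 < α m) (h1 : ∀ m, α m < 1)
    (t : ℕ) : Continuous (value E π T (finiteSpectrum p α) t) := by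
  -- The bound `r ≤ T` ensures that each step uses the dynamics at a period before `T`.
  have key : ∀ r ≤ T, Continuous (valueToGo E π T (finiteSpectrum p α) r) := by
    intro r
    induction r with
    | zero => exact fun _ => continuous_const
    | succ r ih =>
      intro hr
      exact (hcont.isContinuousFamily hπ (by omega) (ih (by omega))).continuous_spectralRisk
        hp h0 h1
  exact key _ (Nat.sub_le _ _)

end Dynamics

/-! ### Networks for the components of the value function -/

/-- The first entry and the successive differences of a finite sequence. -/
def increment {n : ℕ} (q : Fin n → ℝ) (m : Fin n) : ℝ :=
  if h : 0 < m.val then q m - q ⟨m.val - 1, by omega⟩ else q m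

theorem sum_Iic_increment {n : ℕ} (q : Fin n → ℝ) (m : Fin n) :
    ∑ l ∈ Finset.Iic m, increment q l = q m := by
  obtain ⟨k, hk⟩ := m
  induction k with
  | zero =>
    have : Finset.Iic (⟨0, hk⟩ : Fin n) = {⟨0, hk⟩} := by
      ext l
      simp only [Finset.mem_Iic, Finset.mem_singleton, Fin.le_def, Fin.ext_iff]
      omega
    simp [this, increment]
  | succ k ih =>
    have : Finset.Iic (⟨k + 1, hk⟩ : Fin n) =
        insert ⟨k + 1, hk⟩ (Finset.Iic ⟨k, by omega⟩) := by
      ext l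
      simp only [Finset.mem_Iic, Finset.mem_insert, Fin.le_def, Fin.ext_iff]
      omega
    rw [this, Finset.sum_insert (by simp [Fin.le_def]), ih]
    simp [increment]

theorem increment_nonneg_of_monotone {n : ℕ} {q : Fin n → ℝ} (hq : Monotone q) {m : Fin n}
    (hm : 0 < m.val) : 0 ≤ increment q m := by
  rw [increment, dif_pos hm]
  exact sub_nonneg.2 (hq (Fin.le_def.2 (Nat.sub_le _ _)))

theorem continuous_increment {n : ℕ} {X : Type*} [TopologicalSpace X] {q : X → Fin n → ℝ}
    (hq : ∀ m, Continuous fun x => q x m) (m : Fin n) : Continuous fun x => increment (q x) m := by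
  unfold increment
  split_ifs
  · exact (hq _).sub (hq _)
  · exact hq m

section Approximation

variable {d T : ℕ} {S : Set (Fin d → ℝ)} {σ : ℝ → ℝ}

/-- Approximating `h + ε / 2` within `ε / 2` makes the error one-sided, so nonnegativity of `h`
passes to the network. One network serves all periods because `Fin T × S` is compact and embeds in
the input space. -/
theorem IsSigmoid.exists_network_timeState (hσ : IsSigmoid σ) (hS : IsCompact S)
    {h : ℕ → S → ℝ} (hc : ∀ t < T, Continuous (h t)) {ε : ℝ} (hε : 0 < ε) :
    ∃ N : Network (d + 1), ∀ t < T, ∀ s : S, h t s ≤ N.eval σ (timeState t s) ∧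
      N.eval σ (timeState t s) ≤ h t s + ε := by
  have := isCompact_iff_compactSpace.1 hS
  let e : C(Fin T × S, Fin (d + 1) → ℝ) := ⟨fun x => timeState x.1 (x.2 : Fin d → ℝ), by
    refine continuous_pi fun i => ?_
    refine Fin.cases ?_ (fun j => ?_) i
    · exact (continuous_of_discreteTopology (f := fun t : Fin T => ((t : ℕ) : ℝ))).comp
        continuous_fst
    · exact (continuous_apply j).comp (continuous_subtype_val.comp continuous_snd)⟩
  have he : Function.Injective e := by
    rintro ⟨t, s⟩ ⟨t', s'⟩ hts
    obtain ⟨h1, h2⟩ := Fin.cons_injective2 (α := fun _ => ℝ)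
      (show Fin.cons ((t : ℕ) : ℝ) (s : Fin d → ℝ) = Fin.cons ((t' : ℕ) : ℝ) (s' : Fin d → ℝ)
        from hts)
    exact Prod.ext (Fin.ext (by exact_mod_cast h1)) (Subtype.ext h2)
  obtain ⟨N, hN⟩ := hσ.exists_network e he
    ⟨fun x => h x.1 x.2 + ε / 2, continuous_prod_of_discrete_left.2 fun t =>
      (hc t t.2).add continuous_const⟩ (half_pos hε)
  refine ⟨N, fun t ht s => ?_⟩
  have := abs_lt.1 (hN (⟨t, ht⟩, s))
  simp only [ContinuousMap.coe_mk, e] at this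
  constructor <;> linarith

/-- Networks for the increments of continuous levels `q₁ ≤ … ≤ qₙ` and for the excess of `V` over
a weighted mean of the levels. -/
theorem IsSigmoid.exists_networks_of_levels (hσ : IsSigmoid σ) (hS : IsCompact S) {n : ℕ}
    {p : Fin n → ℝ} (hp : ∀ m, 0 ≤ p m) (hp_sum : ∑ m, p m = 1) {V : ℕ → S → ℝ}
    {q : ℕ → S → Fin n → ℝ} (hV : ∀ t < T, Continuous (V t))
    (hq : ∀ t < T, ∀ m, Continuous fun s => q t s m) (hmono : ∀ t < T, ∀ s, Monotone (q t s))
    (hle : ∀ t < T, ∀ s, ∑ m, p m * q t s m ≤ V t s) {ε : ℝ} (hε : 0 < ε) :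
    ∃ (H : Fin n → Network (d + 1)) (Hk : Network (d + 1)), ∀ t < T, ∀ s : S,
      ((∀ m : Fin n, 0 < m.val → 0 ≤ (H m).eval σ (timeState t s)) ∧
        0 ≤ Hk.eval σ (timeState t s)) ∧
      |V t s - (Hk.eval σ (timeState t s) +
        ∑ m, p m * ∑ l ∈ Finset.Iic m, (H l).eval σ (timeState t s))| ≤ ε ∧
      (∀ m, |increment (q t s) m - (H m).eval σ (timeState t s)| ≤ ε) ∧
      |(V t s - ∑ m, p m * q t s m) - Hk.eval σ (timeState t s)| ≤ ε := by
  -- Each partial sum collects at most `n` errors, the weights `p` average them, and `Hk` adds one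
  -- more.
  set η : ℝ := ε / (n + 1) with hηdef
  have hη : 0 < η := by positivity
  have hηε : η * (n + 1) = ε := by rw [hηdef]; field_simp
  have hηle : η ≤ ε := div_le_self hε.le (by linarith [n.cast_nonneg (α := ℝ)])
  choose H hH using fun m : Fin n => hσ.exists_network_timeState (T := T) hS
    (h := fun t s => increment (q t s) m) (fun t ht => continuous_increment (hq t ht) m) hη
  obtain ⟨Hk, hHk⟩ := hσ.exists_network_timeState (T := T) hS
    (h := fun t s => V t s - ∑ m, p m * q t s m)
    (fun t ht => (hV t ht).sub (continuous_finsetSum _ fun m _ => (hq t ht m).const_mul _)) hη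
  refine ⟨H, Hk, fun t ht s => ?_⟩
  have hk := hHk t ht s
  have hm := fun m => hH m t ht s
  refine ⟨⟨fun m h0 => (increment_nonneg_of_monotone (hmono t ht s) h0).trans (hm m).1,
    (sub_nonneg.2 (hle t ht s)).trans hk.1⟩, ?_, fun m => ?_, ?_⟩
  · have hlow : ∑ m, p m * q t s m ≤
        ∑ m, p m * ∑ l ∈ Finset.Iic m, (H l).eval σ (timeState t s) := by
      refine Finset.sum_le_sum fun m _ => mul_le_mul_of_nonneg_left ?_ (hp m)
      rw [← sum_Iic_increment (q t s) m]
      exact Finset.sum_le_sum fun l _ => (hm l).1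
    have hup : ∑ m, p m * ∑ l ∈ Finset.Iic m, (H l).eval σ (timeState t s) ≤
        ∑ m, p m * q t s m + n * η := by
      have h1 : ∑ m, p m * q t s m + n * η = ∑ m, p m * (q t s m + n * η) := by
        simp only [mul_add, Finset.sum_add_distrib, ← Finset.sum_mul, hp_sum, one_mul]
      rw [h1]
      refine Finset.sum_le_sum fun m _ => mul_le_mul_of_nonneg_left ?_ (hp m)
      refine (Finset.sum_le_sum fun l _ => (hm l).2).trans ?_
      rw [Finset.sum_add_distrib, sum_Iic_increment, Finset.sum_const, nsmul_eq_mul]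
      have hcard : ((Finset.Iic m).card : ℝ) ≤ n := by
        exact_mod_cast (Finset.card_le_univ _).trans_eq (Fintype.card_fin n)
      gcongr
    rw [abs_le]
    constructor <;> linarith [hk.1, hk.2]
  · rw [abs_le]
    constructor <;> linarith [(hm m).1, (hm m).2]
  · rw [abs_le]
    constructor <;> linarith [hk.1, hk.2]

end Approximation

/-- The slack `δ < ε` is needed: a strict pointwise bound by `ε` would only give `≤` for the
essential supremum. -/
theorem essSup_enorm_lt_of_abs_le {X : Type*} [MeasurableSpace X] {f : X → ℝ} {δ ε : ℝ}
    (hδε : δ < ε) (hε : 0 < ε) (hf : ∀ x, |f x| ≤ δ) (μ : Measure X) :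
    essSup (fun x => ‖f x‖ₑ) μ < ENNReal.ofReal ε := by
  refine (essSup_le_of_ae_le (ENNReal.ofReal δ) (Eventually.of_forall fun x => ?_)).trans_lt
    ((ENNReal.ofReal_lt_ofReal_iff hε).2 hδε)
  rw [← ofReal_norm]
  exact ENNReal.ofReal_le_ofReal (hf x)

end SpectralRL

end

/-! ### Choice of the levels and conclusion -/

open SpectralRL in
theorem mainTheorem3 {d : ℕ} (S : Set (Fin d → ℝ)) (hS : IsCompact S)
    {A : Type*} [MeasurableSpace A]
    (E : Environment S A) (π : ℕ → Kernel S A) (hπ : ∀ t, IsMarkovKernel (π t))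
    (T : ℕ) (hcont : ContinuousDynamics E π T)
    {n : ℕ} (p α : Fin n → ℝ)
    (hp_pos : ∀ m, 0 < p m) (hp_le : ∀ m, p m ≤ 1) (hp_sum : ∑ m, p m = 1)
    (hα_mono : StrictMono α) (hα_pos : ∀ m, 0 < α m) (hα_lt : ∀ m, α m < 1)
    (σ : ℝ → ℝ) (hσ : IsSigmoid σ) (ε : ℝ) (hε : 0 < ε) :
    ∃ (H : Fin n → Network (d + 1)) (Hk : Network (d + 1)),
      -- the sign constraints on the networks with index `2, …, k`
      (∀ t < T, ∀ s : S, (∀ m : Fin n, 0 < m.val → 0 ≤ (H m).eval σ (timeState t s)) ∧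
        0 ≤ Hk.eval σ (timeState t s)) ∧
      -- approximation of the value function
      (∀ t < T, ∀ μ : Measure S,
        essSup (fun s : S => ‖value E π T (finiteSpectrum p α) t s -
          (Hk.eval σ (timeState t s) +
            ∑ m, p m * ∑ l ∈ Finset.Iic m, (H l).eval σ (timeState t s))‖ₑ) μ
          < ENNReal.ofReal ε) ∧
      -- if quantiles are unique, the networks approximate the individual components
      ((∀ t < T, ∀ s : S, ∀ m : Fin n,
          ∃! x, IsQuantile (α m) (riskToGoLaw E π T (finiteSpectrum p α) t s) x) →
        ∀ t < T, ∀ μ : Measure S,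
          (∀ m : Fin n,
            essSup (fun s : S => ‖varIncrement α (riskToGoLaw E π T (finiteSpectrum p α) t s) m -
              (H m).eval σ (timeState t s)‖ₑ) μ < ENNReal.ofReal ε) ∧
          essSup (fun s : S => ‖spectralExcess p α (riskToGoLaw E π T (finiteSpectrum p α) t s) -
            Hk.eval σ (timeState t s)‖ₑ) μ < ENNReal.ofReal ε) := by 
  have := isCompact_iff_compactSpace.1 hS
  have hp0 := fun m => (hp_pos m).le
  have hfam : ∀ t < T, IsContinuousFamily (riskToGoLaw E π T (finiteSpectrum p α) t) :=
    fun t ht => hcont.isContinuousFamily hπ ht (hcont.continuous_value hπ hp0 hα_pos hα_lt (t + 1))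
  have hprob : ∀ t < T, ∀ s,
      IsProbabilityMeasure (riskToGoLaw E π T (finiteSpectrum p α) t s) :=
    fun t ht => (hfam t ht).isProbabilityMeasure
  have hV : ∀ t < T, Continuous (value E π T (finiteSpectrum p α) t) :=
    fun t _ => hcont.continuous_value hπ hp0 hα_pos hα_lt t
  have hlevels : ∀ t < T, ∀ s, ∀ q : Fin n → ℝ,
      (∀ m, q m ≤ CVaR (α m) (riskToGoLaw E π T (finiteSpectrum p α) t s)) →
      ∑ m, p m * q m ≤ value E π T (finiteSpectrum p α) t s := fun t ht s q hq => by
    rw [value_eq E π T _ t ht, spectralRisk_finiteSpectrum p α hp0 (fun m => (hα_pos m).le)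
      fun m => (hα_lt m).le]
    exact Finset.sum_le_sum fun m _ => mul_le_mul_of_nonneg_left (hq m) (hp0 m)
  -- The same networks must serve both claims, so the levels are chosen according to whether
  -- uniqueness holds; if it fails, the last claim is vacuous.
  by_cases huniq : ∀ t < T, ∀ s : S, ∀ m : Fin n,
      ∃! x, IsQuantile (α m) (riskToGoLaw E π T (finiteSpectrum p α) t s) x
  · obtain ⟨H, Hk, h⟩ := hσ.exists_networks_of_levels hS hp0 hp_sum hV
      (q := fun t s m => VaR (α m) (riskToGoLaw E π T (finiteSpectrum p α) t s))
      (fun t ht m => (hfam t ht).continuous_VaR (hα_pos m) (hα_lt m) fun s => huniq t ht s m)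
      (fun t ht s m m' hm => by
        have := hprob t ht s
        exact VaR_mono (hα_pos m) (hα_mono.monotone hm) (hα_lt m'))
      (fun t ht s => hlevels t ht s _ fun m => by
        have := hprob t ht s
        exact VaR_le_CVaR ((hfam t ht).integrable s) (hα_pos m) (hα_lt m))
      (half_pos hε)
    refine ⟨H, Hk, fun t ht s => (h t ht s).1, fun t ht μ => ?_, fun _ t ht μ => ⟨fun m => ?_, ?_⟩⟩
    · exact essSup_enorm_lt_of_abs_le (half_lt_self hε) hε (fun s => (h t ht s).2.1) μ
    -- For these levels `increment` is `varIncrement` by definition.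
    · exact essSup_enorm_lt_of_abs_le (half_lt_self hε) hε (fun s => (h t ht s).2.2.1 m) μ
    · refine essSup_enorm_lt_of_abs_le (half_lt_self hε) hε (fun s => ?_) μ
      rw [spectralExcess, ← value_eq E π T _ t ht]
      exact (h t ht s).2.2.2
  · obtain ⟨δ, hδ1, hδ⟩ : ∃ δ : ℝ, (∀ m, α m + δ < 1) ∧ 0 < δ := by
      have h1 : ∀ᶠ δ in 𝓝[>] (0 : ℝ), ∀ m, α m + δ < 1 := eventually_all.2 fun m =>
        ((continuous_const.add continuous_id).continuousAt.eventually_lt_const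
          (by simpa using hα_lt m)).filter_mono nhdsWithin_le_nhds
      exact (h1.and self_mem_nhdsWithin).exists
    obtain ⟨H, Hk, h⟩ := hσ.exists_networks_of_levels hS hp0 hp_sum hV
      (q := fun t s m => meanVaR δ (α m) (riskToGoLaw E π T (finiteSpectrum p α) t s))
      (fun t ht m => (hfam t ht).continuous_meanVaR hδ (hα_pos m) (hδ1 m))
      (fun t ht s m m' hm => by
        have := hprob t ht s
        exact meanVaR_mono ((hfam t ht).integrable s) hδ (hα_pos m) (hα_mono.monotone hm)
          (hδ1 m'))
      (fun t ht s => hlevels t ht s _ fun m => by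
        have := hprob t ht s
        exact meanVaR_le_CVaR ((hfam t ht).integrable s) hδ (hα_pos m) (hδ1 m))
      (half_pos hε)
    exact ⟨H, Hk, fun t ht s => (h t ht s).1, fun t ht μ =>
      essSup_enorm_lt_of_abs_le (half_lt_self hε) hε (fun s => (h t ht s).2.1) μ,
      fun hu => absurd hu huniq⟩
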